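/- Let $n\ge 1$, $k\ge 0$ be integers and let $\varepsilon\ge 0$ be real. Let $T$ denote the cyclic shift $T|j\rangle=|j+1\rangle$ on $\mathbb{C}^{2n}$ (indices in $\mathbb{Z}/2n$), and let $w=1^n0^n$, with $(T^jw)_i=w_{i-j}$. *Ordered search.* In the $n$-element ordered search problem the instances are the strings $0^j1^{n-j}$, $j\in\{0,\dots,n-1\}$, and the answer is $j$. In its symmetrized form the instances are the $2n$ strings $T^jw$, $j\in\mathbb{Z}/2n$, and the answer is $j \bmod n$. *Quantum query algorithms.* A $k$-query quantum algorithm acts on a finite-dimensional space with an arbitrary workspace. It is given by a unit vector $|\psi_0\rangle$ and unitaries $U_1,\dots,U_k$, none depending on the instance. On instance $x$ it ends in the state $|\psi^{(x)}_k\rangle=U_kO_xU_{k-1}\cdots U_1O_x|\psi_0\rangle$, where the phase oracle $O_x$ multiplies a basis state with query index $i$ by $(-1)^{x_i}$; null (equivalently, controlled) queries, on which the oracle acts trivially, are also allowed. The algorithm solves a problem with error $\varepsilon$ if there are orthogonal projectors $\Pi_y$, indexed by the possible answers $y$ and with pairwise orthogonal supports, such that $\|\Pi_{f(x)}|\psi^{(x)}_k\rangle\|^2\ge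 1-\varepsilon$ for every instance $x$, where $f(x)$ is the correct answer. *Translation-invariant algorithms.* A $k$-query algorithm for symmetrized ordered search is translation-invariant if it acts on the single $2n$-dimensional query register $\mathbb{C}^{2n}$ (no workspace, no null queries), $O_y|i\rangle=(-1)^{y_i}|i\rangle$, its initial state is $\frac1{\sqrt{2n}}\sum_{j=0}^{2n-1}|j\rangle$, $TU_tT^{-1}=U_t$ for all $t\in\{1,\dots,k\}$, and the measurement is given by the projectors $\Pi_j=|\phi_j\rangle\langle\phi_j|$ with $|\phi_j\rangle=\frac1{\sqrt2}\bigl(|j\rangle+(-1)^k|j+n\rangle\bigr)$, $j=0,\dots,n-1$. **Theorem.** If some $k$-query quantum algorithm solves $n$-element ordered search, in its original or in its symmetrized form, with error $\varepsilon$, then some $k$-query translation-invariant algorithm solves $n$-element symmetrized ordered search with error $\varepsilon$, that is, $|\langle\phi_{j\bmod n}|\psi_k^{(T^jw)}\rangle|^2\ge 1-\varepsilon$ for all $j\in\{0,\dots,2n-1\}$. -/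

import Mathlib

open scoped Matrix

namespace OrderedSearch

/-! ## Query problems and quantum query algorithms -/

/-- A query problem: every instance `x : X` hides a bitstring `bits x` indexed by `I`;
the task is to output `answer x : Y` given query access to `bits x`. -/
structure QueryProblem (X I Y : Type*) where
  bits : X → I → Bool
  answer : X → Y

/-- A `k`-query quantum algorithm with query locations `I` on the finite-dimensional Hilbert space
`ℂ^B` with computational basis `B`.  The oracle call looks up the location `query b` written in the
basis state `b`; `query b = none` is a null query.

Uncontrolled queries with workspace `W`: `B = I × W` and `query (i, w) = some i`.
Controlled queries: `B = Bool × I × W`, `query (true, i, w) = some i`, `query (false, i, w) = none`.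

The algorithm is given by a unit vector `init` and unitaries `U 0, …, U (k - 1)`, none of which
depends on the instance. -/
structure QueryAlgorithm (I B : Type*) [Fintype B] [DecidableEq B] (k : ℕ) where
  query : B → Option I
  init : B → ℂ
  norm_init : ‖WithLp.toLp 2 init‖ = 1
  U : Fin k → Matrix.unitaryGroup B ℂ

namespace QueryAlgorithm

variable {X I Y B : Type*} [Fintype B] [DecidableEq B] {k : ℕ}

/-- The eigenvalue of the phase oracle for the bitstring `x` at the basis state `b`:
`(-1) ^ x_i` if `b` queries location `i`, and `1` for a null query. -/
def phase (A : QueryAlgorithm I B k) (x : I → Bool) (b : B) : ℂ :=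
  match A.query b with
  | none => 1
  | some i => if x i then -1 else 1

/-- The phase oracle `O_x`. -/
def oracle (A : QueryAlgorithm I B k) (x : I → Bool) : Matrix B B ℂ :=
  Matrix.diagonal (A.phase x)

/-- The state after `t` queries on the bitstring `x`:
`state 0 = init` and `state (t + 1) = U_{t + 1} O_x (state t)`. -/
def state (A : QueryAlgorithm I B k) (x : I → Bool) (t : Fin (k + 1)) : B → ℂ :=
  Fin.induction (motive := fun _ => B → ℂ) A.init
    (fun s ψ => (A.U s : Matrix B B ℂ) *ᵥ (A.oracle x *ᵥ ψ)) t

/-- The final state `U_k O_x U_{k-1} ⋯ U_1 O_x |ψ₀⟩`. -/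
def finalState (A : QueryAlgorithm I B k) (x : I → Bool) : B → ℂ :=
  A.state x (Fin.last k)

/-- `P` solves the problem with error `ε` from the final states of `A`: `P` is a family of
orthogonal projectors with pairwise orthogonal supports, and on each instance the correct answer is
obtained with probability at least `1 - ε`. -/
def SolvesWith (A : QueryAlgorithm I B k) (F : QueryProblem X I Y) (ε : ℝ)
    (P : Y → Matrix B B ℂ) : Prop :=
  (∀ y, IsStarProjection (P y)) ∧ (∀ y y', y ≠ y' → P y * P y' = 0) ∧
    ∀ x : X, 1 - ε ≤ ‖WithLp.toLp 2 (P (F.answer x) *ᵥ A.finalState (F.bits x))‖ ^ 2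

end QueryAlgorithm

/-- Some `k`-query quantum algorithm, with arbitrary finite-dimensional workspace and null queries
allowed, solves the problem `F` with error `ε`. -/
def QuantumSolvable {X I Y : Type*} (F : QueryProblem X I Y) (k : ℕ) (ε : ℝ) : Prop :=
  ∃ (B : Type) (_ : Fintype B) (_ : DecidableEq B) (A : QueryAlgorithm I B k)
    (P : Y → Matrix B B ℂ), A.SolvesWith F ε P

/-! ## The ordered search problem -/

/-- Ordered search: the instance `j ∈ {0, …, n-1}` is the string `0^j 1^(n-j)`; output `j`. -/
def orderedSearch (n : ℕ) : QueryProblem (Fin n) (Fin n) (Fin n) where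
  bits j i := decide (j ≤ i)
  answer j := j

/-- Symmetrized ordered search: the instance `j ∈ ℤ/2n` is the string `T^j w`, where
`w = 1^n 0^n`, so that `(T^j w)_i = w_{i-j}`; output `j mod n`. -/
def symmetrizedOrderedSearch (n : ℕ) [NeZero n] :
    QueryProblem (ZMod (2 * n)) (ZMod (2 * n)) (Fin n) where
  bits j i := decide ((i - j).val < n)
  answer j := ⟨j.val % n, Nat.mod_lt _ (NeZero.pos n)⟩

/-! ## Translation-invariant algorithms -/

/-- The cyclic shift `T |j⟩ = |j + 1⟩` on `ℂ^(ℤ/2n)`. -/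
def shift (n : ℕ) : Matrix (ZMod (2 * n)) (ZMod (2 * n)) ℂ :=
  Matrix.of fun i j => if i = j + 1 then 1 else 0

/-- The measurement vector `|φ_j⟩ = (|j⟩ + (-1)^k |j + n⟩) / √2`. -/
noncomputable def phi (n k : ℕ) (j : Fin n) : ZMod (2 * n) → ℂ :=
  ((1 / Real.sqrt 2 : ℝ) : ℂ) •
    (Pi.single ((j : ℕ) : ZMod (2 * n)) 1 +
      (-1 : ℂ) ^ k • Pi.single (((j : ℕ) : ZMod (2 * n)) + (n : ZMod (2 * n))) 1)

/-- The rank-one projector `|φ_j⟩⟨φ_j|`. -/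
noncomputable def phiProj (n k : ℕ) (j : Fin n) : Matrix (ZMod (2 * n)) (ZMod (2 * n)) ℂ :=
  Matrix.vecMulVec (phi n k j) (star (phi n k j))

/-- The conditions on the initial state and on the unitaries of a translation-invariant algorithm.
It acts on the query register `ℂ^(ℤ/2n)` alone (no workspace, no null queries), starts in the
uniform superposition, and its unitaries are invariant under conjugation by the shift. -/
structure IsTranslationInvariant {n k : ℕ} [NeZero n]
    (A : QueryAlgorithm (ZMod (2 * n)) (ZMod (2 * n)) k) : Prop where
  query_eq : ∀ i, A.query i = some i
  init_eq : ∀ i, A.init i = ((1 / Real.sqrt (2 * n) : ℝ) : ℂ)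
  conj_shift : ∀ t, shift n * (A.U t : Matrix (ZMod (2 * n)) (ZMod (2 * n)) ℂ) * (shift n)⁻¹ = A.U t

/-- Some `k`-query translation-invariant algorithm, measured in the vectors `|φ_j⟩`, solves
`n`-element (symmetrized) ordered search with error `ε`. -/
def TranslationInvariantSolvable (n : ℕ) [NeZero n] (k : ℕ) (ε : ℝ) : Prop :=
  ∃ A : QueryAlgorithm (ZMod (2 * n)) (ZMod (2 * n)) k,
    IsTranslationInvariant A ∧ A.SolvesWith (symmetrizedOrderedSearch n) ε (phiProj n k)

end OrderedSearch

/-! Let ψ_t(j) be the state of the given algorithm after t queries on instance j, and take its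
discrete Fourier transform in j. The norms ‖𝓕ψ_t(p)‖ survive instance-independent unitaries, and
they alone limit the final measurement: its average success probability is at most 2S²/(2n)³ with S
= ∑ₚ ‖𝓕ψ_k(p)‖ (`card_mul_sqrt_le_sum_norm_dft`).

A translation-invariant algorithm is a sequence of vectors g_t on ℤ/2n, its amplitudes on w. A
circulant unitary takes `halfSign * g_t` to g_{t+1} as soon as their power spectra agree
(`exists_circulant_unitary`). So it suffices to find g_t such that g_t and `halfSign * g_t` have, up
to scaling and p ↦ -p, the spectra of ψ_t and ψ_{t+1}. Each basis state b provides such a vector,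
and the spectra must be summed over b. Without null queries, complementing the instance only changes
a sign, so each of these vectors is determined by its half on {0, …, n-1}, and both spectra are
fixed multiples of that of the half. Spectral factorization (`exists_norm_sq_dft_eq_sum`), a
discrete Fejér–Riesz argument, merges the halves into one vector.

At the last step the phases are free. Taking 𝓕g_k ≥ 0 maximizes |g_k(0)|, and the success
probability 2|g_k(0)|² equals the upper bound on every instance. -/

namespace OrderedSearch

open ZMod Finset
open scoped ComplexConjugate

/-! ### Fourier analysis on ℤ/N and circulant unitaries -/

section Fourier

variable {N : ℕ} [NeZero N]

theorem conj_stdAddChar (a : ZMod N) : conj (stdAddChar a : ℂ) = stdAddChar (-a) :=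
  (AddChar.map_neg_eq_conj _ _).symm

theorem norm_stdAddChar (a : ZMod N) : ‖(stdAddChar a : ℂ)‖ = 1 := by
  rw [stdAddChar_apply, Circle.norm_coe]

theorem dft_comp_add {E : Type*} [AddCommGroup E] [Module ℂ E] (f : ZMod N → E) (a p : ZMod N) :
    𝓕 (fun i ↦ f (i + a)) p = (stdAddChar (a * p) : ℂ) • 𝓕 f p := by
  simp only [dft_apply, smul_sum, smul_smul, ← AddChar.map_add_eq_mul]
  refine Fintype.sum_equiv (Equiv.addRight a) _ _ fun i ↦ ?_
  simp only [Equiv.coe_addRight]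
  congr 2
  ring

theorem dft_comp_sub_left {E : Type*} [AddCommGroup E] [Module ℂ E] (f : ZMod N → E)
    (a p : ZMod N) :
    𝓕 (fun i ↦ f (a - i)) p = (stdAddChar (-(a * p)) : ℂ) • 𝓕 f (-p) := by
  simp only [dft_apply, smul_sum, smul_smul, ← AddChar.map_add_eq_mul]
  refine Fintype.sum_equiv (Equiv.subLeft a) _ _ fun i ↦ ?_
  simp only [Equiv.subLeft_apply]
  congr 2
  ring

theorem sum_inner_dft {E : Type*} [NormedAddCommGroup E] [InnerProductSpace ℂ E]
    (f g : ZMod N → E) :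
    ∑ p, inner ℂ (𝓕 f p) (𝓕 g p) = N * ∑ j, inner ℂ (f j) (g j) := by
  simp only [dft_apply, sum_inner, inner_sum, inner_smul_left, inner_smul_right, conj_stdAddChar]
  rw [sum_comm, mul_sum]
  refine sum_congr rfl fun i _ ↦ ?_
  simp only [mul_sum]
  rw [sum_comm]
  have h (j : ZMod N) : ∑ p : ZMod N, (stdAddChar (-(i * p)) : ℂ) *
      (stdAddChar (- -(j * p)) * inner ℂ (f j) (g i)) =
      if j = i then N * inner ℂ (f i) (g i) else 0 := by
    simp only [← mul_assoc, ← AddChar.map_add_eq_mul, ← sum_mul]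
    have : ∀ p : ZMod N, -(i * p) + - -(j * p) = p * (j - i) := fun p ↦ by ring
    simp only [this, AddChar.sum_mulShift _ (isPrimitive_stdAddChar N), sub_eq_zero]
    split_ifs with hji
    · simp [hji, ZMod.card]
    · simp
  simp only [h, sum_ite_eq', mem_univ, if_true]

theorem sum_norm_sq_dft {E : Type*} [NormedAddCommGroup E] [InnerProductSpace ℂ E]
    (f : ZMod N → E) : ∑ p, ‖𝓕 f p‖ ^ 2 = N * ∑ j, ‖f j‖ ^ 2 := by
  have h := sum_inner_dft f f
  apply Complex.ofReal_injective
  push_cast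
  simpa [inner_self_eq_norm_sq_to_K] using h

/-- The circulant matrix acting on the Fourier side as multiplication by `θ`. -/
noncomputable def fourierMultiplier (θ : ZMod N → ℂ) : Matrix (ZMod N) (ZMod N) ℂ :=
  Matrix.of fun i j ↦ (N : ℂ)⁻¹ * ∑ p, θ p * stdAddChar (p * (i - j))

theorem dft_fourierMultiplier_mulVec (θ f : ZMod N → ℂ) :
    𝓕 (fourierMultiplier θ *ᵥ f) = θ * 𝓕 f := by
  rw [← LinearEquiv.eq_symm_apply]
  ext i
  simp only [Matrix.mulVec, dotProduct, fourierMultiplier, Matrix.of_apply, invDFT_apply,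
    Pi.mul_apply, dft_apply, smul_eq_mul, mul_sum, sum_mul]
  rw [sum_comm]
  refine sum_congr rfl fun p _ ↦ sum_congr rfl fun j _ ↦ ?_
  rw [show p * (i - j) = p * i + -(j * p) by ring, AddChar.map_add_eq_mul]
  ring

theorem fourierMultiplier_mul (θ φ : ZMod N → ℂ) :
    fourierMultiplier θ * fourierMultiplier φ = fourierMultiplier (θ * φ) := by
  refine Matrix.ext_of_mulVec_single fun i ↦ (dft (N := N) (E := ℂ)).injective ?_
  rw [← Matrix.mulVec_mulVec]
  simp only [dft_fourierMultiplier_mulVec, mul_assoc]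

theorem fourierMultiplier_one : fourierMultiplier (1 : ZMod N → ℂ) = 1 := by
  refine Matrix.ext_of_mulVec_single fun i ↦ (dft (N := N) (E := ℂ)).injective ?_
  rw [dft_fourierMultiplier_mulVec, one_mul, Matrix.one_mulVec]

theorem star_fourierMultiplier (θ : ZMod N → ℂ) :
    star (fourierMultiplier θ) = fourierMultiplier (star θ) := by
  ext i j
  simp only [Matrix.star_apply, fourierMultiplier, Matrix.of_apply, star_mul', star_sum, star_inv₀,
    star_natCast, Pi.star_apply]
  congr 1
  refine sum_congr rfl fun p _ ↦ ?_
  congr 1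
  rw [← starRingEnd_apply, conj_stdAddChar]
  congr 1
  ring

/-- Two vectors with the same power spectrum are related by a circulant unitary. -/
theorem exists_circulant_unitary {f g : ZMod N → ℂ} (h : ∀ p, ‖𝓕 f p‖ ^ 2 = ‖𝓕 g p‖ ^ 2) :
    ∃ U ∈ Matrix.unitaryGroup (ZMod N) ℂ, (∀ i j a, U (i + a) (j + a) = U i j) ∧ U *ᵥ f = g := by
  -- Where `𝓕 f p` vanishes so does `𝓕 g p`; the value 1 only keeps θ unimodular there.
  let θ : ZMod N → ℂ := fun p ↦ if 𝓕 f p = 0 then 1 else 𝓕 g p / 𝓕 f p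
  have hn (p) : ‖𝓕 f p‖ = ‖𝓕 g p‖ := by
    simpa [abs_of_nonneg] using (sq_eq_sq_iff_abs_eq_abs _ _).1 (h p)
  have hθ : θ * star θ = 1 := by
    ext p
    simp only [Pi.mul_apply, Pi.star_apply, Pi.one_apply, RCLike.star_def, Complex.mul_conj']
    by_cases h0 : 𝓕 f p = 0
    · simp [θ, h0]
    · simp [θ, h0, ← hn]
  refine ⟨fourierMultiplier θ, ?_, fun i j a ↦ ?_, (dft (N := N) (E := ℂ)).injective ?_⟩
  · rw [Matrix.mem_unitaryGroup_iff, star_fourierMultiplier, fourierMultiplier_mul, hθ,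
      fourierMultiplier_one]
  · simp [fourierMultiplier]
  · rw [dft_fourierMultiplier_mulVec]
    ext p
    by_cases h0 : 𝓕 f p = 0
    · have := hn p
      rw [h0, norm_zero, eq_comm, norm_eq_zero] at this
      simp [θ, h0, this]
    · simp [θ, h0]

end Fourier

/-! ### Spectral factorization by compactness -/

section SpectralFactorization

variable {N : ℕ} [NeZero N]

theorem norm_sq_add_norm_sq_rotate (a b x y : ℂ) :
    ‖conj a * x + conj b * y‖ ^ 2 + ‖a * y - b * x‖ ^ 2 =
      (‖a‖ ^ 2 + ‖b‖ ^ 2) * (‖x‖ ^ 2 + ‖y‖ ^ 2) := by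
  simp only [← Complex.normSq_eq_norm_sq, Complex.normSq_apply, Complex.add_re, Complex.add_im,
    Complex.sub_re, Complex.sub_im, Complex.mul_re, Complex.mul_im, Complex.conj_re,
    Complex.conj_im]
  ring

/-- The pairs of vectors supported on `{0, …, m - 1}` with joint power spectrum `R`. -/
def spectralPairs (m : ℕ) (R : ZMod N → ℝ) : Set ((ZMod N → ℂ) × (ZMod N → ℂ)) :=
  {q | (∀ i, m ≤ i.val → q.1 i = 0 ∧ q.2 i = 0) ∧ ∀ p, ‖𝓕 q.1 p‖ ^ 2 + ‖𝓕 q.2 p‖ ^ 2 = R p}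

theorem isCompact_spectralPairs (m : ℕ) (R : ZMod N → ℝ) : IsCompact (spectralPairs m R) := by
  have hc (p : ZMod N) : Continuous fun f : ZMod N → ℂ ↦ 𝓕 f p :=
    (continuous_apply p).comp (dft (N := N) (E := ℂ)).toLinearMap.continuous_of_finiteDimensional
  refine Metric.isCompact_of_isClosed_isBounded ?_ ?_
  · simp only [spectralPairs, Set.ofPred_and, Set.ofPred_forall]
    refine .inter ?_ ?_
    · refine isClosed_iInter fun i ↦ isClosed_iInter fun _ ↦ .inter ?_ ?_
      · exact isClosed_eq (by fun_prop) continuous_const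
      · exact isClosed_eq (by fun_prop) continuous_const
    · refine isClosed_iInter fun p ↦ isClosed_eq ?_ continuous_const
      exact (((hc p).comp continuous_fst).norm.pow 2).add (((hc p).comp continuous_snd).norm.pow 2)
  · refine isBounded_iff_forall_norm_le.2 ⟨√(∑ p, R p), fun q hq ↦ ?_⟩
    have key : ∑ i, ‖q.1 i‖ ^ 2 + ∑ i, ‖q.2 i‖ ^ 2 ≤ ∑ p, R p := by
      rw [← sum_congr rfl fun p _ ↦ hq.2 p, sum_add_distrib, sum_norm_sq_dft, sum_norm_sq_dft,
        ← mul_add]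
      exact le_mul_of_one_le_left (by positivity) (mod_cast NeZero.one_le)
    have h1 : 0 ≤ ∑ i, ‖q.1 i‖ ^ 2 := by positivity
    have h2 : 0 ≤ ∑ i, ‖q.2 i‖ ^ 2 := by positivity
    refine norm_prod_le_iff.2 ⟨?_, ?_⟩ <;>
      refine (pi_norm_le_iff_of_nonneg (Real.sqrt_nonneg _)).2 fun i ↦ Real.le_sqrt_of_sq_le ?_
    · linarith [single_le_sum (f := fun i ↦ ‖q.1 i‖ ^ 2) (fun _ _ ↦ by positivity) (mem_univ i)]
    · linarith [single_le_sum (f := fun i ↦ ‖q.2 i‖ ^ 2) (fun _ _ ↦ by positivity) (mem_univ i)]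

/-- A sum of two power spectra of vectors supported on `{0, …, m - 1}` is again such a power
spectrum: among the pairs with the given joint spectrum, one with extremal value at `0` has
vanishing second component. -/
theorem exists_norm_sq_dft_eq_add {m : ℕ} {f g : ZMod N → ℂ} (hf : ∀ i, m ≤ i.val → f i = 0)
    (hg : ∀ i, m ≤ i.val → g i = 0) :
    ∃ h : ZMod N → ℂ, (∀ i, m ≤ i.val → h i = 0) ∧
      ∀ p, ‖𝓕 h p‖ ^ 2 = ‖𝓕 f p‖ ^ 2 + ‖𝓕 g p‖ ^ 2 := by
  obtain ⟨⟨a, b⟩, ⟨hs, hR⟩, hmax⟩ := (isCompact_spectralPairs m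
    fun p ↦ ‖𝓕 f p‖ ^ 2 + ‖𝓕 g p‖ ^ 2).exists_isMaxOn
    ⟨(f, g), fun i hi ↦ ⟨hf i hi, hg i hi⟩, fun p ↦ rfl⟩
    (f := fun q ↦ ‖q.1 0‖) (by fun_prop)
  suffices hb : b = 0 by
    refine ⟨a, fun i hi ↦ (hs i hi).1, fun p ↦ ?_⟩
    simpa [hb] using hR p
  by_contra hb
  -- Moving the first nonzero entry of `b` to position 0 keeps the support in {0, …, m-1} and the
  -- power spectrum unchanged.
  obtain ⟨s, hbs, hmin⟩ : ∃ s, b s ≠ 0 ∧ ∀ i, b i ≠ 0 → s.val ≤ i.val := by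
    obtain ⟨s, hs, hmin⟩ := exists_min_image (univ.filter fun i ↦ b i ≠ 0) ZMod.val
      (by simpa [Finset.Nonempty, funext_iff] using hb)
    exact ⟨s, by simpa using hs, by simpa using hmin⟩
  let b' : ZMod N → ℂ := fun i ↦ b (i + s)
  have hb' (i : ZMod N) (hi : m ≤ i.val) : b' i = 0 := by
    by_contra h0
    have h1 := hmin _ h0
    have h2 : (i + s).val < m := by
      by_contra! h3
      exact h0 (hs _ h3).2
    have h3 := ZMod.val_sub h1
    rw [add_sub_cancel_right] at h3
    omega
  have hFb' (p : ZMod N) : ‖𝓕 b' p‖ = ‖𝓕 b p‖ := by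
    rw [dft_comp_add, norm_smul, norm_stdAddChar, one_mul]
  let r : ℝ := √(‖a 0‖ ^ 2 + ‖b s‖ ^ 2)
  have hr2 : r ^ 2 = ‖a 0‖ ^ 2 + ‖b s‖ ^ 2 := Real.sq_sqrt (by positivity)
  have hbpos : 0 < ‖b s‖ := norm_pos_iff.2 hbs
  have hr : 0 < r := Real.sqrt_pos.2 (by positivity)
  have hrc : (r : ℂ) ≠ 0 := by exact_mod_cast hr.ne'
  -- A unitary rotation of the pair `(a, b')` preserves the joint spectrum. It is chosen to gather
  -- both values at 0 in the first component, so `u 0 = r > ‖a 0‖`, against maximality.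
  let u : ZMod N → ℂ := ((r : ℂ)⁻¹ * conj (a 0)) • a + ((r : ℂ)⁻¹ * conj (b s)) • b'
  let v : ZMod N → ℂ := ((r : ℂ)⁻¹ * a 0) • b' - ((r : ℂ)⁻¹ * b s) • a
  have huv : (u, v) ∈ spectralPairs m fun p ↦ ‖𝓕 f p‖ ^ 2 + ‖𝓕 g p‖ ^ 2 := by
    refine ⟨fun i hi ↦ ?_, fun p ↦ ?_⟩
    · have hai : a i = 0 := (hs i hi).1
      simp [u, v, hb' i hi, hai]
    · have e1 : 𝓕 u p = (r : ℂ)⁻¹ * (conj (a 0) * 𝓕 a p + conj (b s) * 𝓕 b' p) := by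
        simp only [u, map_add, _root_.map_smul, Pi.add_apply, Pi.smul_apply, smul_eq_mul]
        ring
      have e2 : 𝓕 v p = (r : ℂ)⁻¹ * (a 0 * 𝓕 b' p - b s * 𝓕 a p) := by
        simp only [v, map_sub, _root_.map_smul, Pi.sub_apply, Pi.smul_apply, smul_eq_mul]
        ring
      simp only [e1, e2, norm_mul, mul_pow, ← mul_add, norm_sq_add_norm_sq_rotate, ← hr2, hFb']
      have := hR p
      simp only at this
      rw [this, norm_inv, Complex.norm_real, Real.norm_of_nonneg hr.le]
      field_simp
  have h1 := hmax huv
  have h2 : u 0 = r := by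
    simp only [u, b', Pi.add_apply, Pi.smul_apply, smul_eq_mul, zero_add]
    rw [mul_assoc, mul_assoc, Complex.conj_mul', Complex.conj_mul', ← mul_add]
    have : ((‖a 0‖ : ℂ) ^ 2 + (‖b s‖ : ℂ) ^ 2) = (r : ℂ) ^ 2 := by exact_mod_cast hr2.symm
    rw [this]
    field_simp
  simp only [Set.mem_ofPred_eq, h2, Complex.norm_real, Real.norm_of_nonneg hr.le] at h1
  nlinarith [norm_nonneg (a 0)]

/-- Spectral factorization: a finite sum of power spectra of vectors supported on
`{0, …, m - 1}` is the power spectrum of such a vector. -/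
theorem exists_norm_sq_dft_eq_sum {B : Type*} (s : Finset B) {m : ℕ} (f : B → ZMod N → ℂ)
    (hf : ∀ b i, m ≤ i.val → f b i = 0) :
    ∃ h : ZMod N → ℂ, (∀ i, m ≤ i.val → h i = 0) ∧
      ∀ p, ‖𝓕 h p‖ ^ 2 = ∑ b ∈ s, ‖𝓕 (f b) p‖ ^ 2 := by
  classical
  induction s using Finset.induction_on with
  | empty => exact ⟨0, by simp, by simp⟩
  | insert b s hb ih =>
    obtain ⟨g, hg, hgs⟩ := ih
    obtain ⟨h, hh, hhs⟩ := exists_norm_sq_dft_eq_add (hf b) hg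
    exact ⟨h, hh, fun p ↦ by rw [hhs, hgs, sum_insert hb]⟩

end SpectralFactorization

/-! ### Fourier bound on the success of a measurement -/

section MeasurementBound

variable {N : ℕ} [NeZero N] {E : Type*} [NormedAddCommGroup E] [InnerProductSpace ℂ E]

/-- When the square is expanded, only the pairs `(j, j)` and `(j, j + c)` can contribute;
Cauchy–Schwarz and AM-GM bound each of the two families by `∑ j, ‖v j‖ ^ 2`. -/
theorem norm_sq_dft_le_of_inner_eq_zero {v : ZMod N → E} (c : ZMod N)
    (hv : ∀ j j', j' ≠ j → j' ≠ j + c → inner ℂ (v j) (v j') = 0) (p : ZMod N) :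
    ‖𝓕 v p‖ ^ 2 ≤ 2 * ∑ j, ‖v j‖ ^ 2 := by
  have hterm (i j : ZMod N) : (inner ℂ ((stdAddChar (-(i * p)) : ℂ) • v i)
      ((stdAddChar (-(j * p)) : ℂ) • v j)).re ≤
      (if j = i then ‖v i‖ ^ 2 else 0) + if j = i + c then ‖v i‖ * ‖v (i + c)‖ else 0 := by
    by_cases h : j = i ∨ j = i + c
    · have h1 := (Complex.re_le_norm _).trans (norm_inner_le_norm (𝕜 := ℂ)
        ((stdAddChar (-(i * p)) : ℂ) • v i) ((stdAddChar (-(j * p)) : ℂ) • v j))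
      simp only [norm_smul, norm_stdAddChar, one_mul] at h1
      refine h1.trans ?_
      rcases h with rfl | rfl
      · rw [if_pos rfl, ← pow_two]
        exact le_add_of_nonneg_right (by positivity)
      · rw [if_pos (rfl : i + c = i + c)]
        exact le_add_of_nonneg_left (by positivity)
    · push Not at h
      simp [hv i j h.1 h.2, h.1, h.2]
  have hshift : ∑ j, ‖v (j + c)‖ ^ 2 = ∑ j, ‖v j‖ ^ 2 :=
    Equiv.sum_comp (Equiv.addRight c) fun j ↦ ‖v j‖ ^ 2
  calc ‖𝓕 v p‖ ^ 2 = (inner ℂ (𝓕 v p) (𝓕 v p)).re := (inner_self_eq_norm_sq (𝕜 := ℂ) _).symm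
    _ = ∑ i, ∑ j, (inner ℂ ((stdAddChar (-(i * p)) : ℂ) • v i)
          ((stdAddChar (-(j * p)) : ℂ) • v j)).re := by
      simp only [dft_apply, sum_inner, Complex.re_sum]
      simp only [inner_sum, Complex.re_sum]
    _ ≤ ∑ i, (‖v i‖ ^ 2 + ‖v i‖ * ‖v (i + c)‖) := by
      refine sum_le_sum fun i _ ↦ (sum_le_sum fun j _ ↦ hterm i j).trans_eq ?_
      simp [sum_add_distrib]
    _ ≤ ∑ i, (‖v i‖ ^ 2 + (‖v i‖ ^ 2 + ‖v (i + c)‖ ^ 2) / 2) :=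
      sum_le_sum fun i _ ↦ by nlinarith [sq_nonneg (‖v i‖ - ‖v (i + c)‖)]
    _ = 2 * ∑ j, ‖v j‖ ^ 2 := by
      rw [sum_add_distrib, ← sum_div, sum_add_distrib, hshift]
      ring

/-- The success amplitude of a measurement that identifies `j` and `j + c` is bounded by the sum of
the Fourier amplitudes of the measured states. -/
theorem card_mul_sqrt_le_sum_norm_dft {v ψ : ZMod N → E} (c : ZMod N)
    (hv : ∀ j j', j' ≠ j → j' ≠ j + c → inner ℂ (v j) (v j') = 0)
    (hvψ : ∀ j, inner ℂ (v j) (ψ j) = (‖v j‖ : ℂ) ^ 2) :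
    N * √(∑ j, ‖v j‖ ^ 2) ≤ √2 * ∑ p, ‖𝓕 ψ p‖ := by
  set S := ∑ j, ‖v j‖ ^ 2 with hS
  have hS0 : 0 ≤ S := by positivity
  -- Parseval turns `∑ j, ⟪v j, ψ j⟫ = S` into a sum over frequencies, to which Cauchy–Schwarz
  -- applies termwise. Dividing by `√S` then gives the claim.
  have h1 : N * S ≤ √(2 * S) * ∑ p, ‖𝓕 ψ p‖ := by
    have h2 := sum_inner_dft v ψ
    simp only [hvψ] at h2
    have h3 : (N : ℂ) * ∑ j, (‖v j‖ : ℂ) ^ 2 = ((N * S : ℝ) : ℂ) := by simp [hS]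
    rw [h3] at h2
    calc N * S = ‖((N * S : ℝ) : ℂ)‖ := by
          rw [Complex.norm_real, Real.norm_of_nonneg (by positivity)]
      _ ≤ ∑ p, ‖𝓕 v p‖ * ‖𝓕 ψ p‖ := by
        rw [← h2]
        exact norm_sum_le_of_le _ fun p _ ↦ norm_inner_le_norm _ _
      _ ≤ ∑ p, √(2 * S) * ‖𝓕 ψ p‖ := by
        gcongr with p
        exact Real.le_sqrt_of_sq_le (norm_sq_dft_le_of_inner_eq_zero c hv p)
      _ = _ := (mul_sum _ _ _).symm
  rcases hS0.eq_or_lt with h0 | h0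
  · rw [← h0, Real.sqrt_zero, mul_zero]
    positivity
  · rw [Real.sqrt_mul (by norm_num)] at h1
    refine le_of_mul_le_mul_right ?_ (Real.sqrt_pos.2 h0)
    calc N * √S * √S = N * S := by rw [mul_assoc, Real.mul_self_sqrt hS0]
      _ ≤ _ := h1
      _ = _ := by ring

end MeasurementBound

/-! ### Matrices acting on Euclidean space -/

section EuclideanMatrix

variable {B : Type*} [Fintype B]

theorem inner_toLp_mulVec_left (M : Matrix B B ℂ) (x y : B → ℂ) :
    inner ℂ (WithLp.toLp 2 (M *ᵥ x)) (WithLp.toLp 2 y) =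
      inner ℂ (WithLp.toLp 2 x) (WithLp.toLp 2 (star M *ᵥ y)) := by
  rw [EuclideanSpace.inner_toLp_toLp, EuclideanSpace.inner_toLp_toLp, Matrix.star_mulVec,
    dotProduct_comm, ← Matrix.dotProduct_mulVec, dotProduct_comm, Matrix.star_eq_conjTranspose,
    dotProduct_comm]

theorem norm_toLp_unitary_mulVec [DecidableEq B] (U : Matrix.unitaryGroup B ℂ) (x : B → ℂ) :
    ‖WithLp.toLp 2 ((U : Matrix B B ℂ) *ᵥ x)‖ = ‖WithLp.toLp 2 x‖ := by
  have h : inner ℂ (WithLp.toLp 2 ((U : Matrix B B ℂ) *ᵥ x))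
      (WithLp.toLp 2 ((U : Matrix B B ℂ) *ᵥ x)) =
      inner ℂ (WithLp.toLp 2 x) (WithLp.toLp 2 x) := by
    rw [inner_toLp_mulVec_left, Matrix.mulVec_mulVec, Matrix.UnitaryGroup.star_mul_self,
      Matrix.one_mulVec]
  rw [inner_self_eq_norm_sq_to_K, inner_self_eq_norm_sq_to_K] at h
  have h2 : ‖WithLp.toLp 2 ((U : Matrix B B ℂ) *ᵥ x)‖ ^ 2 = ‖WithLp.toLp 2 x‖ ^ 2 := by
    exact_mod_cast h
  exact (sq_eq_sq₀ (norm_nonneg _) (norm_nonneg _)).1 h2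

end EuclideanMatrix

/-! ### Reduction to symmetrized search without null queries -/

section Reduction

namespace QueryAlgorithm

variable {I I' B : Type*} [Fintype B] [DecidableEq B] {k : ℕ}

theorem state_zero (A : QueryAlgorithm I B k) (x : I → Bool) : A.state x 0 = A.init := rfl

theorem state_succ (A : QueryAlgorithm I B k) (x : I → Bool) (t : Fin k) :
    A.state x t.succ =
      (A.U t : Matrix B B ℂ) *ᵥ (A.oracle x *ᵥ A.state x t.castSucc) := by
  simp [state, Fin.induction_succ]

/-- Used with `c = 1` to relabel query locations and with `c = -1` to complement the instance. -/
theorem state_eq_pow_smul {A : QueryAlgorithm I B k} {A' : QueryAlgorithm I' B k}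
    (hinit : A'.init = A.init) (hU : A'.U = A.U) {x : I → Bool} {x' : I' → Bool} {c : ℂ}
    (hc : ∀ b, A'.phase x' b = c * A.phase x b) (t : Fin (k + 1)) :
    A'.state x' t = c ^ (t : ℕ) • A.state x t := by
  have ho : A'.oracle x' = c • A.oracle x := by
    rw [oracle, oracle, ← Matrix.diagonal_smul]
    exact congrArg _ (funext hc)
  induction t using Fin.induction with
  | zero => simp [state_zero, hinit]
  | succ t ih =>
    rw [state_succ, state_succ, ih, ho, hU, Matrix.mulVec_smul, Matrix.smul_mulVec,
      Matrix.mulVec_smul, Matrix.mulVec_smul, smul_smul]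
    simp [pow_succ]

end QueryAlgorithm

variable {n : ℕ} [NeZero n]

theorem val_add_half (a : ZMod (2 * n)) :
    (a + (n : ZMod (2 * n))).val = if a.val < n then a.val + n else a.val - n := by
  have hn := NeZero.pos n
  have ha := a.val_lt
  rw [ZMod.val_add, ZMod.val_natCast, Nat.mod_eq_of_lt (by omega : n < 2 * n)]
  split_ifs with h
  · rw [Nat.mod_eq_of_lt (by omega)]
  · rw [Nat.mod_eq_sub_mod (by omega), Nat.mod_eq_of_lt (by omega)]
    omega

theorem half_add_half {n : ℕ} : (n : ZMod (2 * n)) + n = 0 := by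
  rw [← two_mul]
  exact_mod_cast ZMod.natCast_self (2 * n)

theorem neg_half {n : ℕ} : -(n : ZMod (2 * n)) = n := neg_eq_of_add_eq_zero_left half_add_half

theorem val_add_half_lt_iff (a : ZMod (2 * n)) :
    (a + (n : ZMod (2 * n))).val < n ↔ ¬ a.val < n := by
  have := a.val_lt
  rw [val_add_half]
  split_ifs <;> omega

theorem val_fin_cast {n : ℕ} (j : Fin n) : ((j : ℕ) : ZMod (2 * n)).val = j :=
  ZMod.val_cast_of_lt (by omega)

theorem eq_cast_answer_or (j : ZMod (2 * n)) :
    j = (((symmetrizedOrderedSearch n).answer j : ℕ) : ZMod (2 * n)) ∨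
      j = (((symmetrizedOrderedSearch n).answer j : ℕ) : ZMod (2 * n)) + n := by
  have hj := j.val_lt
  have h : ((symmetrizedOrderedSearch n).answer j : ℕ) = j.val % n := rfl
  rw [h]
  by_cases hn : j.val < n
  · left
    rw [Nat.mod_eq_of_lt hn, ZMod.natCast_zmod_val]
  · right
    rw [Nat.mod_eq_sub_mod (by omega), Nat.mod_eq_of_lt (by omega), ← Nat.cast_add,
      Nat.sub_add_cancel (by omega), ZMod.natCast_zmod_val]

theorem symmetrized_bits_add_half (j i : ZMod (2 * n)) :
    (symmetrizedOrderedSearch n).bits (j + n) i = !(symmetrizedOrderedSearch n).bits j i := by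
  have : i - (j + n) = i - j + n := by rw [← sub_sub, sub_eq_add_neg _ (n : ZMod (2 * n)), neg_half]
  simp only [symmetrizedOrderedSearch, this, val_add_half_lt_iff, decide_not]

/-- Without null queries, complementing the instance changes the state by a sign. -/
theorem state_add_half {B : Type*} [Fintype B] [DecidableEq B] {k : ℕ}
    {A : QueryAlgorithm (ZMod (2 * n)) B k} (hA : ∀ b, A.query b ≠ none) (j : ZMod (2 * n))
    (t : Fin (k + 1)) :
    A.state ((symmetrizedOrderedSearch n).bits (j + n)) t =
      (-1 : ℂ) ^ (t : ℕ) • A.state ((symmetrizedOrderedSearch n).bits j) t := by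
  refine QueryAlgorithm.state_eq_pow_smul rfl rfl (fun b ↦ ?_) t
  obtain ⟨i, hi⟩ := Option.ne_none_iff_exists'.1 (hA b)
  simp only [QueryAlgorithm.phase, hi, symmetrized_bits_add_half]
  cases (symmetrizedOrderedSearch n).bits j i <;> simp

/-- If the instances `x j` of `F` have the bits of symmetrized ordered search at suitable locations,
where a null query counts as the bit `0`, then an algorithm for `F` gives one for symmetrized
ordered search that makes no null queries. -/
theorem exists_solvesWith_symmetrized {X I : Type*} {F : QueryProblem X I (Fin n)} {k : ℕ} {ε : ℝ}
    (x : Fin n → X) (hx : ∀ j, F.answer (x j) = j) (loc : Option I → ZMod (2 * n))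
    (hnone : ∀ j : Fin n, (symmetrizedOrderedSearch n).bits (j : ℕ) (loc none) = false)
    (hsome : ∀ (j : Fin n) i,
      (symmetrizedOrderedSearch n).bits (j : ℕ) (loc (some i)) = F.bits (x j) i)
    (h : QuantumSolvable F k ε) :
    ∃ (B : Type) (_ : Fintype B) (_ : DecidableEq B) (A : QueryAlgorithm (ZMod (2 * n)) B k)
      (P : Fin n → Matrix B B ℂ),
      (∀ b, A.query b ≠ none) ∧ A.SolvesWith (symmetrizedOrderedSearch n) ε P := by
  obtain ⟨B, _, _, A, P, hP, hPP, hA⟩ := h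
  let A' : QueryAlgorithm (ZMod (2 * n)) B k :=
    { query := fun b ↦ some (loc (A.query b))
      init := A.init
      norm_init := A.norm_init
      U := A.U }
  have hA' : ∀ b, A'.query b ≠ none := fun b ↦ Option.some_ne_none _
  have hstate (j : Fin n) :
      A'.finalState ((symmetrizedOrderedSearch n).bits (j : ℕ)) = A.finalState (F.bits (x j)) := by
    refine (QueryAlgorithm.state_eq_pow_smul (c := 1) (A := A) (A' := A')
      (x := F.bits (x j)) rfl rfl (fun b ↦ ?_)
      _).trans ?_
    · rw [one_mul]
      simp only [QueryAlgorithm.phase, A']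
      cases A.query b with
      | none => simp [hnone]
      | some i => simp [hsome]
    · rw [one_pow, one_smul, QueryAlgorithm.finalState]
  refine ⟨B, _, _, A', P, hA', hP, hPP, fun j ↦ ?_⟩
  set y := (symmetrizedOrderedSearch n).answer j with hy
  have hAy := hA (x y)
  rw [hx, ← hstate] at hAy
  have hj := eq_cast_answer_or j
  rw [← hy] at hj
  rcases hj with hj | hj
  · rw [hj]
    exact hAy
  · rw [hj, QueryAlgorithm.finalState, state_add_half hA', Matrix.mulVec_smul, WithLp.toLp_smul,
      norm_smul]
    simpa [QueryAlgorithm.finalState] using hAy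

/-- Location -1 can stand in for a null query: `2n - 1 - j ≥ n` because `j ≤ n - 1`. The instances
`j + n` are recovered afterwards by complementation. -/
theorem symmetrized_bits_neg_one (j : Fin n) :
    (symmetrizedOrderedSearch n).bits (j : ℕ) (-1) = false := by
  have hj := j.isLt
  have h : (-1 - ((j : ℕ) : ZMod (2 * n))) = ((2 * n - 1 - j : ℕ) : ZMod (2 * n)) := by
    rw [Nat.cast_sub (by omega), Nat.cast_sub (by omega), ZMod.natCast_self]
    simp
  simp only [symmetrizedOrderedSearch, h, decide_eq_false_iff_not, not_lt]
  rw [ZMod.val_cast_of_lt (by omega)]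
  omega

theorem symmetrized_bits_eq_orderedSearch_bits (j i : Fin n) :
    (symmetrizedOrderedSearch n).bits (j : ℕ) ((i : ℕ) : ZMod (2 * n)) =
      (orderedSearch n).bits j i := by
  have hj := j.isLt
  have hi := i.isLt
  simp only [symmetrizedOrderedSearch, orderedSearch, decide_eq_decide, Fin.le_def]
  by_cases h : (j : ℕ) ≤ i
  · rw [← Nat.cast_sub h, ZMod.val_cast_of_lt (by omega)]
    omega
  · have e : (((i : ℕ) : ZMod (2 * n)) - ((j : ℕ) : ZMod (2 * n))) =
        ((2 * n - (j - i) : ℕ) : ZMod (2 * n)) := by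
      rw [Nat.cast_sub (by omega), Nat.cast_sub (by omega), ZMod.natCast_self]
      simp
    rw [e, ZMod.val_cast_of_lt (by omega)]
    omega

/-- An algorithm for either form of ordered search gives one for the symmetrized form that makes
no null queries. -/
theorem exists_solvesWith_symmetrized_of_quantumSolvable {k : ℕ} {ε : ℝ}
    (h : QuantumSolvable (symmetrizedOrderedSearch n) k ε ∨
      QuantumSolvable (orderedSearch n) k ε) :
    ∃ (B : Type) (_ : Fintype B) (_ : DecidableEq B) (A : QueryAlgorithm (ZMod (2 * n)) B k)
      (P : Fin n → Matrix B B ℂ),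
      (∀ b, A.query b ≠ none) ∧ A.SolvesWith (symmetrizedOrderedSearch n) ε P := by
  rcases h with h | h
  · refine exists_solvesWith_symmetrized (F := symmetrizedOrderedSearch n) (fun j ↦ (j : ℕ)) (fun j ↦ ?_)
      (fun o ↦ o.getD (-1)) symmetrized_bits_neg_one (fun _ _ ↦ rfl) h
    ext
    simp only [symmetrizedOrderedSearch, val_fin_cast]
    exact Nat.mod_eq_of_lt j.isLt
  · exact exists_solvesWith_symmetrized (F := orderedSearch n) id (fun _ ↦ rfl)
      (fun o ↦ o.elim (-1) fun i ↦ ((i : ℕ) : ZMod (2 * n)))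
      symmetrized_bits_neg_one symmetrized_bits_eq_orderedSearch_bits h

end Reduction

/-! ### Amplitudes of the translation-invariant algorithm -/

section Symmetrization

variable {n : ℕ} [NeZero n]

/-- The sign `(-1) ^ w_i` of the phase oracle for the string `w = 1^n 0^n`. -/
noncomputable def halfSign (i : ZMod (2 * n)) : ℂ := if i.val < n then -1 else 1

/-- A vector with `f (i + n) = e f i` and its half on `{0, …, n - 1}` have proportional Fourier
transforms, also after applying the oracle. -/
theorem dft_eq_mul_dft_half {e : ℂ} {f f₀ : ZMod (2 * n) → ℂ}
    (hf₀ : ∀ i, n ≤ i.val → f₀ i = 0) (hf : ∀ i, f i = f₀ i + e * f₀ (i + n))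
    (p : ZMod (2 * n)) :
    𝓕 f p = (1 + e * stdAddChar ((n : ZMod (2 * n)) * p)) * 𝓕 f₀ p ∧
      𝓕 (halfSign * f) p = (-1 + e * stdAddChar ((n : ZMod (2 * n)) * p)) * 𝓕 f₀ p := by
  have h1 : f = f₀ + e • fun i ↦ f₀ (i + n) := funext hf
  have h2 : halfSign * f = -f₀ + e • fun i ↦ f₀ (i + n) := by
    ext i
    simp only [Pi.mul_apply, Pi.add_apply, Pi.neg_apply, Pi.smul_apply, smul_eq_mul, hf, halfSign]
    split_ifs with h
    · have : f₀ (i + n) = 0 := hf₀ _ (not_lt.1 fun h' ↦ (val_add_half_lt_iff i).1 h' h)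
      rw [this]
      ring
    · rw [hf₀ i (not_lt.1 h)]
      ring
  rw [h2, h1]
  simp only [map_add, _root_.map_smul, map_neg, Pi.add_apply, Pi.neg_apply, Pi.smul_apply,
    smul_eq_mul, dft_comp_add]
  constructor <;> ring

/-- A family of vectors with `f (i + n) = e f i` can be replaced by a single vector with the same
total power spectrum before and after the oracle is applied. -/
theorem exists_norm_sq_dft_halfSign {B : Type*} [Fintype B] {e : ℂ} (he : e * e = 1)
    (f : B → ZMod (2 * n) → ℂ) (hf : ∀ b i, f b (i + n) = e * f b i) :
    ∃ g : ZMod (2 * n) → ℂ, (∀ p, ‖𝓕 g p‖ ^ 2 = ∑ b, ‖𝓕 (f b) p‖ ^ 2) ∧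
      ∀ p, ‖𝓕 (halfSign * g) p‖ ^ 2 = ∑ b, ‖𝓕 (halfSign * f b) p‖ ^ 2 := by
  let f₀ : B → ZMod (2 * n) → ℂ := fun b i ↦ if i.val < n then f b i else 0
  have hf₀ (b : B) (i : ZMod (2 * n)) (hi : n ≤ i.val) : f₀ b i = 0 := if_neg (not_lt.2 hi)
  have hff₀ (b : B) (i : ZMod (2 * n)) : f b i = f₀ b i + e * f₀ b (i + n) := by
    simp only [f₀, val_add_half_lt_iff, hf]
    split_ifs
    · simp
    · rw [zero_add, ← mul_assoc, he, one_mul]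
  obtain ⟨g₀, hg₀, hg⟩ := exists_norm_sq_dft_eq_sum univ f₀ hf₀
  refine ⟨fun i ↦ g₀ i + e * g₀ (i + n), fun p ↦ ?_, fun p ↦ ?_⟩
  · rw [(dft_eq_mul_dft_half hg₀ (fun _ ↦ rfl) p).1, norm_mul, mul_pow, hg, mul_sum]
    refine sum_congr rfl fun b _ ↦ ?_
    rw [(dft_eq_mul_dft_half (hf₀ b) (hff₀ b) p).1, norm_mul, mul_pow]
  · rw [(dft_eq_mul_dft_half hg₀ (fun _ ↦ rfl) p).2, norm_mul, mul_pow, hg, mul_sum]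
    refine sum_congr rfl fun b _ ↦ ?_
    rw [(dft_eq_mul_dft_half (hf₀ b) (hff₀ b) p).2, norm_mul, mul_pow]

/-- In coordinate `b`, substituting `j = q b - i` reflects the frequency and costs only a phase.
With `q b` the queried location, the oracle becomes multiplication by `halfSign i`, the same for all
`b`. -/
theorem norm_sq_dft_toLp_neg {N : ℕ} [NeZero N] {B : Type*} [Fintype B] (q : B → ZMod N)
    (x : ZMod N → B → ℂ) (p : ZMod N) :
    ‖𝓕 (fun j ↦ WithLp.toLp 2 (x j)) (-p)‖ ^ 2 = ∑ b, ‖𝓕 (fun i ↦ x (q b - i) b) p‖ ^ 2 := by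
  rw [EuclideanSpace.norm_sq_eq]
  refine sum_congr rfl fun b _ ↦ ?_
  rw [dft_comp_sub_left (fun j ↦ x j b), norm_smul, norm_stdAddChar, one_mul]
  simp [dft_apply]

/-- A unitary that does not depend on `j` commutes with the Fourier transform in `j`. -/
theorem norm_dft_toLp_unitary_mulVec {N : ℕ} [NeZero N] {B : Type*} [Fintype B] [DecidableEq B]
    (U : Matrix.unitaryGroup B ℂ) (x : ZMod N → B → ℂ) (p : ZMod N) :
    ‖𝓕 (fun j ↦ WithLp.toLp 2 ((U : Matrix B B ℂ) *ᵥ x j)) p‖ =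
      ‖𝓕 (fun j ↦ WithLp.toLp 2 (x j)) p‖ := by
  have h (y : ZMod N → B → ℂ) : 𝓕 (fun j ↦ WithLp.toLp 2 (y j)) p =
      WithLp.toLp 2 (∑ j, (stdAddChar (-(j * p)) : ℂ) • y j) := by
    simp [dft_apply]
  rw [h, h, ← norm_toLp_unitary_mulVec U (∑ j, _ • x j), Matrix.mulVec_sum]
  simp only [Matrix.mulVec_smul]

variable {B : Type*} [Fintype B] [DecidableEq B] {k : ℕ}

/-- The state on instance `j` of symmetrized ordered search, as a Euclidean vector. -/
noncomputable def symState (A : QueryAlgorithm (ZMod (2 * n)) B k) (t : Fin (k + 1))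
    (j : ZMod (2 * n)) : EuclideanSpace ℂ B :=
  WithLp.toLp 2 (A.state ((symmetrizedOrderedSearch n).bits j) t)

theorem symState_zero (A : QueryAlgorithm (ZMod (2 * n)) B k) (j : ZMod (2 * n)) :
    symState A 0 j = WithLp.toLp 2 A.init := rfl

theorem symState_add_half {A : QueryAlgorithm (ZMod (2 * n)) B k} (hA : ∀ b, A.query b ≠ none)
    (t : Fin (k + 1)) (j : ZMod (2 * n)) :
    symState A t (j + n) = (-1 : ℂ) ^ (t : ℕ) • symState A t j := by
  rw [symState, state_add_half hA, WithLp.toLp_smul, symState]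

theorem phase_symmetrized_bits {A : QueryAlgorithm (ZMod (2 * n)) B k} {b : B} {i : ZMod (2 * n)}
    (hb : A.query b = some i) (j : ZMod (2 * n)) :
    A.phase ((symmetrizedOrderedSearch n).bits j) b = halfSign (i - j) := by
  simp [QueryAlgorithm.phase, hb, symmetrizedOrderedSearch, halfSign]

theorem norm_sq_dft_symState_succ {A : QueryAlgorithm (ZMod (2 * n)) B k} {q : B → ZMod (2 * n)}
    (hq : ∀ b, A.query b = some (q b)) (t : Fin k) (p : ZMod (2 * n)) :
    ‖𝓕 (symState A t.succ) (-p)‖ ^ 2 = ∑ b, ‖𝓕 (halfSign * fun i ↦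
      A.state ((symmetrizedOrderedSearch n).bits (q b - i)) t.castSucc b) p‖ ^ 2 := by
  unfold symState
  simp only [QueryAlgorithm.state_succ]
  rw [norm_dft_toLp_unitary_mulVec, norm_sq_dft_toLp_neg q]
  refine sum_congr rfl fun b _ ↦ ?_
  refine congrArg (fun f ↦ ‖𝓕 f p‖ ^ 2) (funext fun i ↦ ?_)
  simp [QueryAlgorithm.oracle, Matrix.mulVec_diagonal, phase_symmetrized_bits (hq b)]

theorem sum_stdAddChar_neg_mul {N : ℕ} [NeZero N] (p : ZMod N) :
    ∑ j : ZMod N, (stdAddChar (-(j * p)) : ℂ) = if p = 0 then (N : ℂ) else 0 := by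
  have := AddChar.sum_mulShift (-p) (isPrimitive_stdAddChar N)
  simpa [ZMod.card] using this

theorem norm_dft_symState_zero (A : QueryAlgorithm (ZMod (2 * n)) B k) (p : ZMod (2 * n)) :
    ‖𝓕 (symState A 0) (-p)‖ = if p = 0 then ((2 * n : ℕ) : ℝ) else 0 := by
  rw [dft_apply]
  simp only [symState_zero, ← sum_smul, sum_stdAddChar_neg_mul, norm_smul, A.norm_init]
  split_ifs <;> simp_all

/-- The amplitudes of a translation-invariant algorithm on the instance `w`: uniform at the
beginning, nonnegative in the Fourier basis at the end, and at each step with the power spectrum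
of the given algorithm both before and after the query. -/
theorem exists_amplitudes {A : QueryAlgorithm (ZMod (2 * n)) B k} (hA : ∀ b, A.query b ≠ none) :
    ∃ g : Fin (k + 1) → ZMod (2 * n) → ℂ, (∀ i, g 0 i = ((1 / √(2 * n) : ℝ) : ℂ)) ∧
      (∀ p, 𝓕 (g (Fin.last k)) p =
        ((1 / √(2 * n) * ‖𝓕 (symState A (Fin.last k)) (-p)‖ : ℝ) : ℂ)) ∧
      ∀ (t : Fin k) p, ‖𝓕 (halfSign * g t.castSucc) p‖ ^ 2 = ‖𝓕 (g t.succ) p‖ ^ 2 := by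
  choose q hq using fun b ↦ Option.ne_none_iff_exists'.1 (hA b)
  have hpos : (0 : ℝ) < 2 * n := by
    have := NeZero.pos n
    positivity
  have hsq : √(2 * n : ℝ) * √(2 * n) = 2 * n := Real.mul_self_sqrt hpos.le
  set r : ℝ := 1 / √(2 * n) with hr
  have hr0 : 0 ≤ r := by positivity
  have hr2 : r ^ 2 * (2 * n) = 1 := by
    rw [hr, div_pow, pow_two √_, hsq, one_pow, one_div, inv_mul_cancel₀ hpos.ne']
  -- The vectors for different `t` can be chosen independently, since consecutive ones are linked
  -- only through prescribed spectra. If `k = 0`, the choice at `t = 0` must also meet the final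
  -- condition.
  suffices H : ∀ t : Fin (k + 1), ∃ g : ZMod (2 * n) → ℂ, (t = 0 → ∀ i, g i = (r : ℂ)) ∧
      (t = Fin.last k → ∀ p, 𝓕 g p = ((r * ‖𝓕 (symState A t) (-p)‖ : ℝ) : ℂ)) ∧
      (∀ p, ‖𝓕 g p‖ ^ 2 = r ^ 2 * ‖𝓕 (symState A t) (-p)‖ ^ 2) ∧
      ∀ s : Fin k, t = s.castSucc → ∀ p,
        ‖𝓕 (halfSign * g) p‖ ^ 2 = r ^ 2 * ‖𝓕 (symState A s.succ) (-p)‖ ^ 2 by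
    choose g h0 h1 h2 h3 using H
    exact ⟨g, h0 0 rfl, h1 _ rfl, fun t p ↦ by rw [h3 _ t rfl, h2]⟩
  intro t
  by_cases ht0 : t = 0
  · subst ht0
    have hF (p : ZMod (2 * n)) : 𝓕 (fun _ : ZMod (2 * n) ↦ (r : ℂ)) p =
        ((r * ‖𝓕 (symState A 0) (-p)‖ : ℝ) : ℂ) := by
      rw [norm_dft_symState_zero, dft_apply]
      simp only [smul_eq_mul, ← sum_mul, sum_stdAddChar_neg_mul]
      split_ifs
      · push_cast
        ring
      · simp
    refine ⟨fun _ ↦ r, fun _ _ ↦ rfl, fun _ ↦ hF, fun p ↦ ?_, fun s hs p ↦ ?_⟩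
    · rw [hF, Complex.norm_real, Real.norm_of_nonneg (by positivity), mul_pow]
    -- The initial amplitudes do not depend on the instance, so for each `b` the vector is constant
    -- and no factorization is needed.
    · have hinit : ∑ b, ‖A.init b‖ ^ 2 = 1 := by
        have := EuclideanSpace.norm_sq_eq (WithLp.toLp 2 A.init)
        rw [A.norm_init] at this
        simpa using this.symm
      have hmul (c : ℂ) : ‖𝓕 (halfSign * fun _ : ZMod (2 * n) ↦ c) p‖ ^ 2 =
          ‖c‖ ^ 2 * ‖𝓕 (halfSign (n := n)) p‖ ^ 2 := by
        have : (halfSign * fun _ : ZMod (2 * n) ↦ c) = c • halfSign := by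
          ext i
          simp [mul_comm]
        rw [this, _root_.map_smul, Pi.smul_apply, norm_smul, mul_pow]
      rw [norm_sq_dft_symState_succ hq, ← hs]
      simp only [QueryAlgorithm.state_zero, hmul, ← sum_mul, hinit, Complex.norm_real,
        Real.norm_eq_abs, sq_abs, one_mul]
  by_cases htk : t = Fin.last k
  · subst htk
    -- No query follows, so only the spectrum of `g` itself is prescribed and its Fourier phases may
    -- be set to 1.
    refine ⟨𝓕⁻ fun p ↦ ((r * ‖𝓕 (symState A (Fin.last k)) (-p)‖ : ℝ) : ℂ), fun h ↦ (ht0 h).elim,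
      fun _ p ↦ ?_, fun p ↦ ?_, fun s hs ↦ ?_⟩
    · rw [LinearEquiv.apply_symm_apply]
    · rw [LinearEquiv.apply_symm_apply, Complex.norm_real, Real.norm_of_nonneg (by positivity),
        mul_pow]
    · exact ((Fin.castSucc_lt_last s).ne hs.symm).elim
  · obtain ⟨s, rfl⟩ := Fin.exists_castSucc_eq.2 htk
    obtain ⟨g, hg1, hg2⟩ := exists_norm_sq_dft_halfSign (e := (-1) ^ (s : ℕ))
      (by rw [← mul_pow]; simp)
      (fun b i ↦ A.state ((symmetrizedOrderedSearch n).bits (q b - i)) s.castSucc b)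
      (fun b i ↦ by
        have : q b - (i + n) = q b - i + n := by
          rw [← sub_sub, sub_eq_add_neg _ (n : ZMod (2 * n)), neg_half]
        simp [this, state_add_half hA])
    refine ⟨(r : ℂ) • g, fun h ↦ (ht0 h).elim, fun h ↦ (htk h).elim, fun p ↦ ?_, fun s' hs p ↦ ?_⟩
    · rw [_root_.map_smul, Pi.smul_apply, norm_smul, mul_pow, hg1, Complex.norm_real,
        Real.norm_eq_abs, sq_abs]
      unfold symState
      rw [norm_sq_dft_toLp_neg q]
    · obtain rfl := Fin.castSucc_injective _ hs
      rw [mul_smul_comm, _root_.map_smul, Pi.smul_apply, norm_smul, mul_pow, hg2,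
        Complex.norm_real, Real.norm_eq_abs, sq_abs, norm_sq_dft_symState_succ hq]

/-- The optimal success probability, in terms of the Fourier amplitudes of the final states. -/
theorem le_sq_sum_norm_dft_symState {A : QueryAlgorithm (ZMod (2 * n)) B k} {ε : ℝ}
    {P : Fin n → Matrix B B ℂ} (h : A.SolvesWith (symmetrizedOrderedSearch n) ε P) :
    (2 * n) ^ 3 * (1 - ε) ≤ 2 * (∑ p, ‖𝓕 (symState A (Fin.last k)) p‖) ^ 2 := by
  obtain ⟨hP, hPP, hA⟩ := h
  let v : ZMod (2 * n) → EuclideanSpace ℂ B := fun j ↦ WithLp.toLp 2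
    (P ((symmetrizedOrderedSearch n).answer j) *ᵥ
      A.finalState ((symmetrizedOrderedSearch n).bits j))
  have hstar (y : Fin n) : star (P y) = P y := (hP y).isSelfAdjoint
  have hidem (y : Fin n) : P y * P y = P y := (hP y).isIdempotentElem
  have hv (j j' : ZMod (2 * n)) (h1 : j' ≠ j) (h2 : j' ≠ j + n) : inner ℂ (v j) (v j') = 0 := by
    have hne : (symmetrizedOrderedSearch n).answer j ≠ (symmetrizedOrderedSearch n).answer j' := by
      intro he
      have e1 := eq_cast_answer_or j
      have e2 := eq_cast_answer_or j'
      rw [← he] at e2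
      have h0 := half_add_half (n := n)
      rcases e1 with e1 | e1 <;> rcases e2 with e2 | e2
      · exact h1 (e2.trans e1.symm)
      · exact h2 (e2.trans (by rw [← e1]))
      · refine h2 (e2.trans ?_)
        nth_rewrite 2 [e1]
        rw [add_assoc, h0, add_zero]
      · exact h1 (e2.trans e1.symm)
    simp only [v]
    rw [inner_toLp_mulVec_left, Matrix.mulVec_mulVec, hstar, hPP _ _ hne, Matrix.zero_mulVec]
    simp
  have hvψ (j : ZMod (2 * n)) :
      inner ℂ (v j) (symState A (Fin.last k) j) = (‖v j‖ : ℂ) ^ 2 := by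
    have : inner ℂ (v j) (v j) = (‖v j‖ : ℂ) ^ 2 := inner_self_eq_norm_sq_to_K _
    rw [← this]
    simp only [v, symState]
    rw [inner_toLp_mulVec_left, inner_toLp_mulVec_left, Matrix.mulVec_mulVec, hstar, hidem]
    rfl
  have hS : (2 * n : ℝ) * (1 - ε) ≤ ∑ j, ‖v j‖ ^ 2 := by
    have := card_nsmul_le_sum univ (fun j ↦ ‖v j‖ ^ 2) (1 - ε) fun j _ ↦ hA j
    simpa [ZMod.card] using this
  have hb := card_mul_sqrt_le_sum_norm_dft (n : ZMod (2 * n)) hv hvψ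
  have hb2 := pow_le_pow_left₀ (by positivity) hb 2
  rw [mul_pow, mul_pow, Real.sq_sqrt (by positivity), Real.sq_sqrt (by positivity)] at hb2
  push_cast at hb2
  calc (2 * n : ℝ) ^ 3 * (1 - ε) = (2 * n) ^ 2 * ((2 * n) * (1 - ε)) := by ring
    _ ≤ _ := (mul_le_mul_of_nonneg_left hS (by positivity)).trans hb2

end Symmetrization

/-! ### The measurement vectors -/

section Measurement

variable {n : ℕ} [NeZero n]

theorem star_phi_dotProduct (k : ℕ) (j : Fin n) (x : ZMod (2 * n) → ℂ) :
    star (phi n k j) ⬝ᵥ x = ((1 / √2 : ℝ) : ℂ) *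
      (x ((j : ℕ) : ZMod (2 * n)) + (-1) ^ k * x (((j : ℕ) : ZMod (2 * n)) + n)) := by
  have h1 (a : ZMod (2 * n)) : star (Pi.single a 1 : ZMod (2 * n) → ℂ) = Pi.single a 1 := by
    rw [← Pi.single_star, star_one]
  rw [phi, star_smul, star_add, star_smul, h1, h1, smul_dotProduct, add_dotProduct,
    smul_dotProduct, single_one_dotProduct, single_one_dotProduct]
  simp

theorem star_phi_dotProduct_phi (k : ℕ) (j j' : Fin n) :
    star (phi n k j) ⬝ᵥ phi n k j' = if j = j' then 1 else 0 := by
  have e1 : ((j : ℕ) : ZMod (2 * n)) = ((j' : ℕ) : ZMod (2 * n)) ↔ j = j' :=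
    ⟨fun h ↦ Fin.ext (by rw [← val_fin_cast j, h, val_fin_cast]), fun h ↦ by rw [h]⟩
  have e2 (j j' : Fin n) : ((j : ℕ) : ZMod (2 * n)) ≠ ((j' : ℕ) : ZMod (2 * n)) + n := fun h ↦ by
    have := congrArg ZMod.val h
    rw [val_add_half, val_fin_cast, val_fin_cast, if_pos j'.isLt] at this
    omega
  have h2 : ((1 / √2 : ℝ) : ℂ) * ((1 / √2 : ℝ) : ℂ) * 2 = 1 := by
    rw [← Complex.ofReal_mul, div_mul_div_comm, Real.mul_self_sqrt zero_le_two]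
    norm_num
  have h3 : ((-1 : ℂ) ^ k) * (-1) ^ k = 1 := by rw [← mul_pow]; simp
  rw [star_phi_dotProduct]
  simp only [phi, Pi.smul_apply, Pi.add_apply, Pi.single_apply, smul_eq_mul, add_left_inj, e1, e2,
    (e2 j' j).symm, if_false]
  split_ifs
  · linear_combination h2 + ((1 / √2 : ℝ) : ℂ) * ((1 / √2 : ℝ) : ℂ) * h3
  · simp

theorem isStarProjection_phiProj (k : ℕ) (j : Fin n) : IsStarProjection (phiProj n k j) where
  isIdempotentElem := by
    rw [IsIdempotentElem, phiProj, Matrix.vecMulVec_mul_vecMulVec, star_phi_dotProduct_phi]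
    simp
  isSelfAdjoint := by
    rw [IsSelfAdjoint, phiProj, Matrix.star_eq_conjTranspose, Matrix.conjTranspose_vecMulVec,
      star_star]

theorem phiProj_mul_phiProj (k : ℕ) {j j' : Fin n} (h : j ≠ j') :
    phiProj n k j * phiProj n k j' = 0 := by
  rw [phiProj, phiProj, Matrix.vecMulVec_mul_vecMulVec, star_phi_dotProduct_phi, if_neg h]
  simp

theorem norm_toLp_phiProj_mulVec (k : ℕ) (j : Fin n) (x : ZMod (2 * n) → ℂ) :
    ‖WithLp.toLp 2 (phiProj n k j *ᵥ x)‖ = ‖star (phi n k j) ⬝ᵥ x‖ := by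
  have h1 : ‖WithLp.toLp 2 (phi n k j)‖ = 1 := by
    have := inner_self_eq_norm_sq (𝕜 := ℂ) (WithLp.toLp 2 (phi n k j))
    rw [EuclideanSpace.inner_toLp_toLp, dotProduct_comm, star_phi_dotProduct_phi, if_pos rfl] at this
    have h2 : ‖WithLp.toLp 2 (phi n k j)‖ ^ 2 = 1 := by simpa using this.symm
    exact (pow_eq_one_iff_of_nonneg (norm_nonneg _) two_ne_zero).1 h2
  rw [phiProj, Matrix.vecMulVec_mulVec, op_smul_eq_smul, WithLp.toLp_smul, norm_smul, h1, mul_one]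

end Measurement
-- Circulant unitaries and shifted instances
section TranslationInvariant

variable {n : ℕ} [NeZero n]

theorem shift_conj_eq_of_circulant {M : Matrix (ZMod (2 * n)) (ZMod (2 * n)) ℂ}
    (hM : ∀ i j a, M (i + a) (j + a) = M i j) : shift n * M * (shift n)⁻¹ = M := by
  have hcomm : shift n * M = M * shift n := by
    ext i j
    have h1 : (shift n * M) i j = M (i - 1) j := by
      simp [Matrix.mul_apply, shift, ← sub_eq_iff_eq_add]
    have h2 : (M * shift n) i j = M i (j + 1) := by
      simp [Matrix.mul_apply, shift]
    rw [h1, h2, ← hM (i - 1) j 1, sub_add_cancel]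
  have hunit : shift n * (shift n)ᵀ = 1 := by
    ext i j
    simp [Matrix.mul_apply, shift, Matrix.one_apply, ← sub_eq_iff_eq_add, eq_comm]
  rw [hcomm, mul_assoc, Matrix.mul_nonsing_inv _ (Matrix.isUnit_det_of_right_inverse hunit),
    mul_one]

/-- Shifting the instance conjugates the oracle by `T`, and circulant unitaries commute with `T`, so
the whole run is shifted. -/
theorem state_eq_of_circulant {k : ℕ} {A : QueryAlgorithm (ZMod (2 * n)) (ZMod (2 * n)) k}
    (hq : ∀ i, A.query i = some i)
    (hU : ∀ t i j a, (A.U t : Matrix (ZMod (2 * n)) (ZMod (2 * n)) ℂ) (i + a) (j + a) =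
      (A.U t : Matrix (ZMod (2 * n)) (ZMod (2 * n)) ℂ) i j)
    {g : Fin (k + 1) → ZMod (2 * n) → ℂ} (h0 : ∀ i j, A.init i = g 0 (i - j))
    (hg : ∀ t : Fin k, (A.U t : Matrix (ZMod (2 * n)) (ZMod (2 * n)) ℂ) *ᵥ
      (halfSign * g t.castSucc) = g t.succ)
    (j : ZMod (2 * n)) (t : Fin (k + 1)) :
    A.state ((symmetrizedOrderedSearch n).bits j) t = fun i ↦ g t (i - j) := by
  induction t using Fin.induction with
  | zero => exact funext fun i ↦ h0 i j
  | succ t ih =>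
    ext i
    rw [QueryAlgorithm.state_succ, ih, ← hg t]
    simp only [Matrix.mulVec, dotProduct, QueryAlgorithm.oracle]
    refine Fintype.sum_equiv (Equiv.subRight j) _ _ fun l ↦ ?_
    rw [← hU t (i - j) _ j]
    simp [Matrix.diagonal_apply, phase_symmetrized_bits (hq l)]

/-- Measuring in the vectors `φ_y` succeeds with amplitude `√2 g 0` on every instance. -/
theorem norm_sq_phiProj_mulVec_answer (k : ℕ) {g : ZMod (2 * n) → ℂ}
    (hg : g n = (-1) ^ k * g 0) (j : ZMod (2 * n)) :
    ‖WithLp.toLp 2 (phiProj n k ((symmetrizedOrderedSearch n).answer j) *ᵥ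
      fun i ↦ g (i - j))‖ ^ 2 = 2 * ‖g 0‖ ^ 2 := by
  have h3 : ((-1 : ℂ) ^ k) * (-1) ^ k = 1 := by rw [← mul_pow]; simp
  have hs : ‖((1 / √2 : ℝ) : ℂ)‖ ^ 2 = 1 / 2 := by
    rw [Complex.norm_real, Real.norm_eq_abs, sq_abs, div_pow, Real.sq_sqrt zero_le_two, one_pow]
  rw [norm_toLp_phiProj_mulVec, star_phi_dotProduct, norm_mul, mul_pow, hs]
  have key : ‖g (((symmetrizedOrderedSearch n).answer j : ℕ) - j) +
      (-1) ^ k * g (((symmetrizedOrderedSearch n).answer j : ℕ) + n - j)‖ = 2 * ‖g 0‖ := by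
    rcases eq_cast_answer_or j with hj | hj
    · rw [← hj, sub_self, add_sub_cancel_left, hg, ← mul_assoc, h3, one_mul, ← two_mul, norm_mul,
        Complex.norm_ofNat]
    · rw [← hj, sub_self, eq_sub_of_add_eq hj.symm, sub_sub_cancel_left, neg_half, hg,
        ← mul_add, norm_mul, ← two_mul, norm_mul]
      simp
  rw [key]
  ring

end TranslationInvariant

theorem translationInvariantSolvable_of_quantumSolvable {n : ℕ} [NeZero n] {k : ℕ} {ε : ℝ}
    (h : QuantumSolvable (symmetrizedOrderedSearch n) k ε ∨
      QuantumSolvable (orderedSearch n) k ε) : TranslationInvariantSolvable n k ε := by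
  obtain ⟨B, _, _, A, P, hA, hP⟩ := exists_solvesWith_symmetrized_of_quantumSolvable h
  obtain ⟨g, hg0, hgk, hg⟩ := exists_amplitudes hA
  choose U hUmem hUcirc hU using fun t ↦ exists_circulant_unitary (hg t)
  have hpos : (0 : ℝ) < 2 * n := by
    have := NeZero.pos n
    positivity
  have hsq : √(2 * n : ℝ) ^ 2 = 2 * n := Real.sq_sqrt hpos.le
  let A' : QueryAlgorithm (ZMod (2 * n)) (ZMod (2 * n)) k :=
    { query := some
      init := fun _ ↦ ((1 / √(2 * n) : ℝ) : ℂ)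
      norm_init := by
        rw [EuclideanSpace.norm_eq, Real.sqrt_eq_one]
        simp only [Complex.norm_real, Real.norm_eq_abs, sq_abs, div_pow, one_pow, hsq, sum_const,
          card_univ, ZMod.card, nsmul_eq_mul]
        push_cast
        exact mul_one_div_cancel hpos.ne'
      U := fun t ↦ ⟨U t, hUmem t⟩ }
  refine ⟨A', ⟨fun _ ↦ rfl, fun _ ↦ rfl, fun t ↦ shift_conj_eq_of_circulant (hUcirc t)⟩,
    isStarProjection_phiProj k, fun _ _ ↦ phiProj_mul_phiProj k, fun j ↦ ?_⟩
  -- The sign rule for `ψ_k` confines its spectrum to frequencies of one parity; `g` has the same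
  -- spectral support up to reflection and inherits the rule.
  have hhalf : g (Fin.last k) n = (-1) ^ k * g (Fin.last k) 0 := by
    have hfun : (fun i ↦ g (Fin.last k) (i + n)) = (-1 : ℂ) ^ k • g (Fin.last k) := by
      refine (dft (N := 2 * n) (E := ℂ)).injective (funext fun p ↦ ?_)
      have h1 := dft_comp_add (symState A (Fin.last k)) n (-p)
      simp only [symState_add_half hA, Fin.val_last] at h1
      have h2 : 𝓕 (fun i ↦ (-1 : ℂ) ^ k • symState A (Fin.last k) i) (-p) =
          (-1 : ℂ) ^ k • 𝓕 (symState A (Fin.last k)) (-p) :=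
        congrFun (_root_.map_smul dft ((-1 : ℂ) ^ k) (symState A (Fin.last k))) (-p)
      rw [h2] at h1
      rw [dft_comp_add, _root_.map_smul, Pi.smul_apply, hgk, smul_eq_mul, smul_eq_mul]
      by_cases h0 : 𝓕 (symState A (Fin.last k)) (-p) = 0
      · simp [h0]
      · have h3 : (-1 : ℂ) ^ k = stdAddChar ((n : ZMod (2 * n)) * -p) := smul_left_injective ℂ h0 h1
        rw [h3, mul_neg, ← neg_mul, neg_half]
    simpa using congrFun hfun 0
  have hfinal : A'.finalState ((symmetrizedOrderedSearch n).bits j) =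
      fun i ↦ g (Fin.last k) (i - j) :=
    state_eq_of_circulant (fun _ ↦ rfl) hUcirc (fun _ _ ↦ (hg0 _).symm) hU j _
  rw [hfinal, norm_sq_phiProj_mulVec_answer k hhalf]
  set S := ∑ p, ‖𝓕 (symState A (Fin.last k)) p‖ with hS
  -- Fourier inversion at 0 is the plain average of the nonnegative coefficients, with no
  -- cancellation.
  have hg00 : ‖g (Fin.last k) 0‖ ^ 2 = S ^ 2 / (2 * n) ^ 3 := by
    have h1 : g (Fin.last k) 0 = (((2 * n : ℝ)⁻¹ * (1 / √(2 * n) * S) : ℝ) : ℂ) := by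
      rw [← (dft (N := 2 * n) (E := ℂ)).symm_apply_apply (g (Fin.last k)), invDFT_apply]
      simp only [hgk, mul_zero, AddChar.map_zero_eq_one, smul_eq_mul, hS]
      rw [← Equiv.sum_comp (Equiv.neg (ZMod (2 * n)))
        fun p ↦ ‖𝓕 (symState A (Fin.last k)) p‖]
      push_cast
      simp only [mul_sum, one_mul, Equiv.neg_apply]
    rw [h1, Complex.norm_real, Real.norm_eq_abs, sq_abs, mul_pow, mul_pow, div_pow, hsq]
    field_simp
  rw [hg00, ← mul_div_assoc, le_div_iff₀ (by positivity), mul_comm]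
  exact le_sq_sum_norm_dft_symState hP

end OrderedSearch

theorem theorem1 (n : ℕ) [NeZero n] (k : ℕ) (ε : ℝ) (hε : 0 ≤ ε)
    (h : OrderedSearch.QuantumSolvable (OrderedSearch.symmetrizedOrderedSearch n) k ε ∨
      OrderedSearch.QuantumSolvable (OrderedSearch.orderedSearch n) k ε) :
    OrderedSearch.TranslationInvariantSolvable n k ε :=
  OrderedSearch.translationInvariantSolvable_of_quantumSolvable h
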